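/- Let $f\colon\{0,1\}^n\to\{0,1,\perp\}$ be a partial Boolean function (the value $\perp$ means "undefined") and let $F(x,y)=f(x\oplus y)$ for $x,y\in\{0,1\}^n$, where $\oplus$ is bitwise XOR. Let $\mathrm{D_{cc}^{\rightarrow}}(F)$ be the least $t$ for which there are total functions $h\colon\{0,1\}^n\to\{0,1\}^t$ and $\varphi\colon\{0,1\}^t\times\{0,1\}^n\to\{0,1\}$ with $\varphi(h(x),y)=F(x,y)$ whenever $F(x,y)\neq\perp$. Let $\mathrm{NADT^{\oplus}}(f)$ be the least $p$ for which there are strings $s_1,\dots,s_p\in\{0,1\}^n$ and a total function $l\colon\{0,1\}^p\to\{0,1\}$ with $l(\langle s_1,x\rangle,\dots,\langle s_p,x\rangle)=f(x)$ whenever $f(x)\neq\perp$, where $\langle s,x\rangle=\bigoplus_i s_i\wedge x_i$. **Theorem.** Suppose $\mathrm{D_{cc}^{\rightarrow}}(F)=t$ and $f$ is undefined on fewer than $$\binom{n-t+1}{\lfloor (n-t)/2\rfloor-1}$$ inputs, where a binomial coefficient with negative lower index is $0$. Then $\mathrm{NADT^{\oplus}}(f)=t$. Moreover, this threshold is of order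 $2^{n-t}/\sqrt{n-t}$: as $m\to\infty$, $\binom{m+1}{\lfloor m/2\rfloor-1}=\Theta\!\left(2^m/\sqrt m\right)$; in particular it is $O\!\left(2^m/\sqrt m\right)$. -/

import Mathlib

open scoped Matrix

/-- The Boolean cube `{0,1}^n`, identified with the vector space `𝔽₂^n`; its addition `+` is
bitwise XOR. -/
abbrev Cube (n : ℕ) : Type := Fin n → ZMod 2

/-- A partial Boolean function `{0,1}^n → {0,1,⊥}`; the value `none` is `⊥` (undefined). -/
abbrev PartialBoolFun (n : ℕ) : Type := Cube n → Option (ZMod 2)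

/-- The inputs on which `f` is undefined. -/
def undefinedInputs {n : ℕ} (f : PartialBoolFun n) : Finset (Cube n) :=
  Finset.univ.filter fun x => f x = none

/-- The XOR-function `F(x, y) = f(x ⊕ y)` of a partial function `f`. -/
def xorFun {n : ℕ} (f : PartialBoolFun n) : Cube n → Cube n → Option (ZMod 2) :=
  fun x y => f (x + y)

/-- `F` has a one-way protocol with `t` bits of communication: Alice sends `h x`, Bob outputs
`φ (h x) y`, and this output is correct wherever `F` is defined. -/
def HasOneWayProtocol {n : ℕ} (F : Cube n → Cube n → Option (ZMod 2)) (t : ℕ) : Prop :=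
  ∃ (h : Cube n → Cube t) (φ : Cube t → Cube n → ZMod 2),
    ∀ (x y : Cube n) (b : ZMod 2), F x y = some b → φ (h x) y = b

/-- One-way deterministic communication complexity: the least number of bits of a one-way
protocol. -/
noncomputable def oneWayCC {n : ℕ} (F : Cube n → Cube n → Option (ZMod 2)) : ℕ :=
  sInf {t | HasOneWayProtocol F t}

/-- `f` has a non-adaptive parity decision tree with `p` queries: strings `s₁, …, s_p` and a total
function `l` such that `l (⟨s₁, x⟩, …, ⟨s_p, x⟩) = f x` wherever `f` is defined. -/
def HasNADT {n : ℕ} (f : PartialBoolFun n) (p : ℕ) : Prop :=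
  ∃ (s : Fin p → Cube n) (l : Cube p → ZMod 2),
    ∀ (x : Cube n) (b : ZMod 2), f x = some b → l (fun i => s i ⬝ᵥ x) = b

/-- Non-adaptive parity decision tree complexity: the least number of queries. -/
noncomputable def nadt {n : ℕ} (f : PartialBoolFun n) : ℕ :=
  sInf {p | HasNADT f p}

/-- The minimum in `oneWayCC` is over a non-empty set: Alice can send her whole input. -/
theorem hasOneWayProtocol_self {n : ℕ} (F : Cube n → Cube n → Option (ZMod 2)) :
    HasOneWayProtocol F n :=
  ⟨id, fun x y => (F x y).getD 0, fun x y b hb => by simp [hb]⟩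

/-- The minimum in `nadt` is over a non-empty set: one can query every bit. -/
theorem hasNADT_self {n : ℕ} (f : PartialBoolFun n) : HasNADT f n :=
  ⟨fun i => Pi.single i 1, fun x => (f x).getD 0, fun x b hb => by simp [hb]⟩

/-- The binomial coefficient with an integer lower index, equal to `0` if that index is
negative. -/
def intChoose (m : ℕ) (k : ℤ) : ℕ :=
  if 0 ≤ k then m.choose k.toNat else 0

/-- The threshold `binom(m + 1, ⌊m / 2⌋ - 1)`, to be used with `m = n - t`. -/
def undefinedThreshold (m : ℕ) : ℕ :=
  intChoose (m + 1) ((m : ℤ) / 2 - 1)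

/-! Parities give a protocol because they are additive. Conversely, some message of a `t`-bit
protocol is sent on a set `A` of at least `2 ^ (n - t)` inputs. Shifting by an element of `D = A +
A` never turns a defined value of `f` into a different one. Let `V` be the span of `D`, so `dim V ≥
n - t`. If `f` took both values on a coset of `V`, let `B` be the points of the coset with one of
the values. Then `B + D` misses the other value, and `f` is undefined on `(B + D) \ B`. Olson's
inequality gives at least `|D| / 2` such points, too many since twice the threshold is at most `2 ^
(n - t)`. So `f` factors through the quotient by `V`, of dimension at most `t`. -/

open scoped Pointwise

/-! ### Olson's inequality -/

/-- If translates of a finite set by the negatives of its elements all agree with it, then the set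
is (the carrier of) a subgroup. -/
theorem Finset.exists_addSubgroup_eq {G : Type*} [AddCommGroup G] [DecidableEq G] {X : Finset G}
    (h0 : (0 : G) ∈ X) (hX : ∀ x ∈ X, -x +ᵥ X = X) : ∃ H : AddSubgroup G, (H : Set G) = X := by
  have hsub : ∀ x ∈ X, ∀ y ∈ X, y - x ∈ X := fun x hx y hy => by
    rw [← hX x hx, sub_eq_neg_add]
    exact Finset.vadd_mem_vadd_finset hy
  exact ⟨AddSubgroup.ofSub (X : Set G) ⟨0, h0⟩ fun x hx y hy => by
    simpa [sub_eq_add_neg] using hsub y hy x hx, rfl⟩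

/-- **Olson's inequality** for a symmetric generating set `D` containing `0` in a finite abelian
group: a nonempty set `B` with `B + D` not the whole group satisfies `|B + D| ≥ |B| + |D| / 2`. -/
theorem Finset.card_le_two_mul_card_add_sub_card {G : Type*} [AddCommGroup G] [Fintype G]
    [DecidableEq G] {D : Finset G} (h0 : (0 : G) ∈ D) (hneg : ∀ d ∈ D, -d ∈ D)
    (htop : AddSubgroup.closure (D : Set G) = ⊤) {B : Finset G} (hB : B.Nonempty)
    (hBD : B + D ≠ univ) : D.card ≤ 2 * ((B + D).card - B.card) := by
  have hle (Y : Finset G) : Y ⊆ Y + D := Finset.subset_add_left Y h0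
  have hcard (Y : Finset G) : Y.card ≤ (Y + D).card := Finset.card_le_card (hle Y)
  -- Least growth first, then least size: the tie-break will force `X` to be a coset.
  obtain ⟨X, hXmem, hXmin⟩ := Finset.exists_min_image
    (univ.filter fun Y : Finset G => Y.Nonempty ∧ Y + D ≠ univ)
    (fun Y => toLex ((Y + D).card - Y.card, Y.card)) ⟨B, by simp [hB, hBD]⟩
  replace hXmin : ∀ Y : Finset G, Y.Nonempty → Y + D ≠ univ →
      (X + D).card - X.card < (Y + D).card - Y.card ∨
      (X + D).card - X.card = (Y + D).card - Y.card ∧ X.card ≤ Y.card := fun Y h1 h2 => by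
    simpa [Prod.Lex.le_iff] using hXmin Y (by simp [h1, h2])
  obtain ⟨⟨x₀, hx₀⟩, hXD⟩ : X.Nonempty ∧ X + D ≠ univ := by simpa using hXmem
  suffices h : D.card ≤ 2 * ((X + D).card - X.card) by
    have := hXmin B hB hBD
    omega
  clear hXmem
  -- The complement of `X + D` also minimises the growth, so it is at least as large as `X`.
  have hsmall : X.card + (X + D).card ≤ Fintype.card G := by
    have hne : ((X + D)ᶜ).Nonempty := by
      rwa [Finset.nonempty_iff_ne_empty, Ne, Finset.compl_eq_empty_iff]
    have hsub : (X + D)ᶜ + D ⊆ Xᶜ := by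
      intro z hz
      obtain ⟨y, hy, d, hd, rfl⟩ := Finset.mem_add.1 hz
      rw [Finset.mem_compl] at hy ⊢
      exact fun h => hy (by simpa using Finset.add_mem_add h (hneg d hd))
    have h1 := hXmin _ hne fun h => by
      have := hsub (h ▸ Finset.mem_univ x₀)
      simp [hx₀] at this
    have h2 := Finset.card_le_card hsub
    have h3 := hcard (X + D)ᶜ
    have h4 := hcard X
    rw [Finset.card_compl] at h1 h2 h3
    have h5 := Finset.card_le_univ (X + D)
    omega
  -- A translate of `X` which meets `X` is equal to it.
  have htrans (g : G) (hg : (X ∩ (g +ᵥ X)).Nonempty) : g +ᵥ X = X := by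
    have hc : (g +ᵥ X).card = X.card := Finset.card_vadd_finset _ _
    have hcD : ((g +ᵥ X) + D).card = (X + D).card := by
      rw [vadd_add_assoc, Finset.card_vadd_finset]
    have hI : X ∩ (g +ᵥ X) + D ⊆ (X + D) ∩ ((g +ᵥ X) + D) :=
      Finset.subset_inter (Finset.add_subset_add_right Finset.inter_subset_left)
        (Finset.add_subset_add_right Finset.inter_subset_right)
    -- Growth is submodular: if the union grows at least as much as `X`, the intersection grows at
    -- most as much, and minimality of `|X|` applies.
    have hInt := hXmin _ hg fun h => hXD <| Finset.eq_univ_of_forall fun z =>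
      (Finset.mem_inter.1 (hI (h ▸ Finset.mem_univ z))).1
    have h1 := Finset.card_le_card hI
    have h2 := Finset.card_union_add_card_inter X (g +ᵥ X)
    have h3 := Finset.card_union_add_card_inter (X + D) ((g +ᵥ X) + D)
    rw [← Finset.union_add] at h3
    have h4 := hcard X
    have h5 := hcard (X ∩ (g +ᵥ X))
    have h6 := hcard (X ∪ (g +ᵥ X))
    have hpos := Finset.card_pos.2 hg
    have hUn : (X + D).card - X.card ≤ ((X ∪ (g +ᵥ X)) + D).card - (X ∪ (g +ᵥ X)).card := by
      -- When the union has no room left to grow, `hsmall` and the overlap bound its size.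
      by_cases hu : (X ∪ (g +ᵥ X)) + D = univ
      · rw [hu, Finset.card_univ]
        omega
      · have := hXmin _ (hg.mono (Finset.inter_subset_left.trans Finset.subset_union_left)) hu
        omega
    have hI' : X ∩ (g +ᵥ X) = X :=
      Finset.eq_of_subset_of_card_le Finset.inter_subset_left (by omega)
    exact (Finset.eq_of_subset_of_card_le (Finset.inter_eq_left.1 hI') hc.le).symm
  -- Hence the translate of `X` through the origin is a subgroup.
  obtain ⟨H, hH⟩ := Finset.exists_addSubgroup_eq (X := -x₀ +ᵥ X)
    (Finset.mem_vadd_finset.2 ⟨x₀, hx₀, by simp⟩) fun x hx => by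
      obtain ⟨y, hy, rfl⟩ := Finset.mem_vadd_finset.1 hx
      rw [vadd_vadd]
      have := htrans (x₀ - y) ⟨x₀, Finset.mem_inter.2
          ⟨hx₀, Finset.mem_vadd_finset.2 ⟨y, hy, by simp⟩⟩⟩
      conv_rhs => rw [← this, vadd_vadd]
      congr 1
      simp only [vadd_eq_add]
      abel
  rw [← Finset.card_vadd_finset (-x₀) (X + D), ← Finset.card_vadd_finset (-x₀) X,
    ← vadd_add_assoc]
  have hXD' : (-x₀ +ᵥ X) + D ≠ univ := fun h => hXD <| by
    rw [vadd_add_assoc] at h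
    rw [← Finset.card_eq_iff_eq_univ] at h ⊢
    rwa [Finset.card_vadd_finset] at h
  generalize -x₀ +ᵥ X = K at hH hXD'
  have hKmem (z : G) : z ∈ K ↔ z ∈ H := by
    rw [← Finset.mem_coe, ← hH, SetLike.mem_coe]
  obtain ⟨d, hd, hdH⟩ : ∃ d ∈ D, d ∉ H := by
    by_contra! hcon
    have : H = ⊤ := top_le_iff.1 (htop ▸ (AddSubgroup.closure_le H).2 fun d hd => hcon d hd)
    exact hXD' <| Finset.eq_univ_of_forall fun z => hle K ((hKmem z).2 (this ▸ trivial))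
  have hdisj : Disjoint K (d +ᵥ K) := by
    rw [Finset.disjoint_left]
    intro z hz hz'
    obtain ⟨y, hy, rfl⟩ := Finset.mem_vadd_finset.1 hz'
    rw [hKmem] at hz hy
    exact hdH ((H.add_mem_cancel_right hy).1 hz)
  have hsub : K ∪ (d +ᵥ K) ⊆ K + D := Finset.union_subset (hle K) fun z hz => by
    obtain ⟨y, hy, rfl⟩ := Finset.mem_vadd_finset.1 hz
    rw [vadd_eq_add, add_comm d y]
    exact Finset.add_mem_add hy hd
  -- Two disjoint cosets give `|K| ≤ |K + D| / 2`, so the growth is at least `|K + D| / 2 ≥ |D| /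
  -- 2`.
  have h1 := Finset.card_le_card hsub
  rw [Finset.card_union_of_disjoint hdisj, Finset.card_vadd_finset] at h1
  have h2 : D.card ≤ (K + D).card :=
    Finset.card_le_card (Finset.subset_add_right D ((hKmem 0).2 H.zero_mem))
  omega

/-! ### Size of the binomial threshold -/

theorem undefinedThreshold_of_lt_two {m : ℕ} (hm : m < 2) : undefinedThreshold m = 0 := by
  interval_cases m <;> simp [undefinedThreshold, intChoose]

theorem undefinedThreshold_of_two_le {m : ℕ} (hm : 2 ≤ m) :
    undefinedThreshold m = (m + 1).choose (m / 2 - 1) := by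
  have h : ((m : ℤ) / 2 - 1) = ((m / 2 - 1 : ℕ) : ℤ) := by omega
  rw [undefinedThreshold, intChoose, h, if_pos (Int.natCast_nonneg _), Int.toNat_natCast]

/-- The indices `j`, `j + 1` and their mirror images are four distinct terms of row `N`, each at
least `N.choose j`. -/
theorem Nat.four_mul_choose_le_two_pow {N j : ℕ} (h : 2 * j + 2 < N) :
    4 * N.choose j ≤ 2 ^ N := by
  have hle : N.choose j ≤ N.choose (j + 1) := Nat.choose_le_succ_of_lt_half_left (by omega)
  have h1 : N.choose (N - j) = N.choose j := Nat.choose_symm (by omega)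
  have h2 : N.choose (N - (j + 1)) = N.choose (j + 1) := Nat.choose_symm (by omega)
  have hsub : ({j, j + 1, N - j, N - (j + 1)} : Finset ℕ) ⊆ Finset.range (N + 1) := by
    intro i hi
    simp only [Finset.mem_insert, Finset.mem_singleton] at hi
    simp only [Finset.mem_range]
    omega
  have hsum := Finset.sum_le_sum_of_subset (f := fun i => N.choose i) hsub
  rw [Nat.sum_range_choose, Finset.sum_insert, Finset.sum_insert, Finset.sum_insert,
    Finset.sum_singleton] at hsum
  · omega
  all_goals
    simp only [Finset.mem_insert, Finset.mem_singleton]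
    omega

theorem two_mul_undefinedThreshold_le (m : ℕ) : 2 * undefinedThreshold m ≤ 2 ^ m := by
  rcases lt_or_ge m 2 with hm | hm
  · simp [undefinedThreshold_of_lt_two hm]
  · have h := Nat.four_mul_choose_le_two_pow (N := m + 1) (j := m / 2 - 1) (by omega)
    rw [← undefinedThreshold_of_two_le hm, pow_succ] at h
    omega

/-- Squaring avoids roots; the induction rests on `4n(n + 1) ≤ (2n + 1)²`, and its upper counterpart
on `(2n + 1)(2n + 3) ≤ (2n + 2)²`. -/
theorem Nat.sixteen_pow_le_mul_centralBinom_sq {n : ℕ} (hn : 1 ≤ n) :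
    16 ^ n ≤ 4 * n * n.centralBinom ^ 2 := by
  induction n, hn using Nat.le_induction with
  | base => simp [Nat.centralBinom_eq_two_mul_choose]
  | succ n hn ih =>
    have h := Nat.succ_mul_centralBinom_succ n
    have h2 : (n + 1) * (4 * (n + 1) * (n + 1).centralBinom ^ 2) =
        16 * (2 * n + 1) ^ 2 * n.centralBinom ^ 2 := by
      calc _ = 4 * ((n + 1) * (n + 1).centralBinom) ^ 2 := by ring
        _ = _ := by rw [h]; ring
    refine Nat.le_of_mul_le_mul_left ?_ n.succ_pos
    rw [Nat.succ_eq_add_one, h2]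
    calc (n + 1) * 16 ^ (n + 1) = 16 * (n + 1) * 16 ^ n := by ring
      _ ≤ 16 * (n + 1) * (4 * n * n.centralBinom ^ 2) := Nat.mul_le_mul_left _ ih
      _ = 16 * (4 * n * (n + 1)) * n.centralBinom ^ 2 := by ring
      _ ≤ 16 * (2 * n + 1) ^ 2 * n.centralBinom ^ 2 := by
        gcongr
        nlinarith

theorem Nat.mul_centralBinom_sq_le_sixteen_pow (n : ℕ) :
    (2 * n + 1) * n.centralBinom ^ 2 ≤ 16 ^ n := by
  induction n with
  | zero => simp
  | succ n ih =>
    have h := Nat.succ_mul_centralBinom_succ n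
    have h2 : (n + 1) ^ 2 * ((2 * (n + 1) + 1) * (n + 1).centralBinom ^ 2) =
        4 * ((2 * n + 3) * (2 * n + 1)) * ((2 * n + 1) * n.centralBinom ^ 2) := by
      calc _ = (2 * n + 3) * ((n + 1) * (n + 1).centralBinom) ^ 2 := by ring
        _ = _ := by rw [h]; ring
    refine Nat.le_of_mul_le_mul_left ?_ (pow_pos n.succ_pos 2)
    rw [Nat.succ_eq_add_one, h2]
    calc 4 * ((2 * n + 3) * (2 * n + 1)) * ((2 * n + 1) * n.centralBinom ^ 2)
        ≤ 4 * (4 * (n + 1) ^ 2) * 16 ^ n :=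
          Nat.mul_le_mul (Nat.mul_le_mul_left _ (by nlinarith)) ih
      _ = (n + 1) ^ 2 * 16 ^ (n + 1) := by ring

theorem undefinedThreshold_le_centralBinom {m : ℕ} (hm : 2 ≤ m) :
    undefinedThreshold m ≤ 4 * (m / 2).centralBinom := by
  rw [undefinedThreshold_of_two_le hm]
  calc (m + 1).choose (m / 2 - 1) ≤ (2 * (m / 2 + 1)).choose (m / 2 - 1) :=
        Nat.choose_le_choose _ (by omega)
    _ ≤ (m / 2 + 1).centralBinom := Nat.choose_le_centralBinom _ _
    _ ≤ 4 * (m / 2).centralBinom := by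
      have h := Nat.succ_mul_centralBinom_succ (m / 2)
      refine Nat.le_of_mul_le_mul_left ?_ (m / 2).succ_pos
      rw [Nat.succ_eq_add_one, h]
      nlinarith

theorem centralBinom_le_undefinedThreshold {m : ℕ} (hm : 2 ≤ m) :
    (m / 2).centralBinom ≤ 2 * undefinedThreshold m := by
  obtain ⟨k, hk⟩ : ∃ k, m / 2 = k + 1 := ⟨m / 2 - 1, by omega⟩
  have h := Nat.choose_succ_right_eq (2 * (k + 1)) k
  have h1 : (2 * (k + 1)).choose k ≤ (m + 1).choose k := Nat.choose_le_choose _ (by omega)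
  rw [undefinedThreshold_of_two_le hm, hk, Nat.add_sub_cancel,
    Nat.centralBinom_eq_two_mul_choose]
  rw [show 2 * (k + 1) - k = k + 2 by omega] at h
  nlinarith

theorem mul_undefinedThreshold_sq_le {m : ℕ} (hm : 2 ≤ m) :
    m * undefinedThreshold m ^ 2 ≤ 16 * 4 ^ m := by
  calc m * undefinedThreshold m ^ 2
      ≤ (2 * (m / 2) + 1) * (4 * (m / 2).centralBinom) ^ 2 := by
        gcongr
        · omega
        · exact undefinedThreshold_le_centralBinom hm
    _ = 16 * ((2 * (m / 2) + 1) * (m / 2).centralBinom ^ 2) := by ring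
    _ ≤ 16 * 16 ^ (m / 2) := Nat.mul_le_mul_left _ (Nat.mul_centralBinom_sq_le_sixteen_pow _)
    _ = 16 * 4 ^ (2 * (m / 2)) := by rw [pow_mul]; norm_num
    _ ≤ 16 * 4 ^ m := by
        gcongr
        · norm_num
        · omega

theorem four_pow_le_mul_undefinedThreshold_sq {m : ℕ} (hm : 2 ≤ m) :
    4 ^ m ≤ 32 * (m * undefinedThreshold m ^ 2) := by
  calc 4 ^ m ≤ 4 ^ (2 * (m / 2) + 1) := by
        gcongr
        · norm_num
        · omega
    _ = 4 * 16 ^ (m / 2) := by rw [pow_succ, pow_mul]; norm_num; ring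
    _ ≤ 4 * (4 * (m / 2) * (m / 2).centralBinom ^ 2) :=
        Nat.mul_le_mul_left _ (Nat.sixteen_pow_le_mul_centralBinom_sq (by omega))
    _ = 8 * (2 * (m / 2)) * (m / 2).centralBinom ^ 2 := by ring
    _ ≤ 8 * m * (2 * undefinedThreshold m) ^ 2 := by
        gcongr
        · omega
        · exact centralBinom_le_undefinedThreshold hm
    _ = 32 * (m * undefinedThreshold m ^ 2) := by ring

theorem isTheta_undefinedThreshold :
    Asymptotics.IsTheta Filter.atTop
      (fun m : ℕ => (undefinedThreshold m : ℝ))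
      (fun m : ℕ => (2 : ℝ) ^ m / Real.sqrt (m : ℝ)) := by
  have four_pow (m : ℕ) : ((2 : ℝ) ^ m) ^ 2 = 4 ^ m := by
    rw [← pow_mul, mul_comm, pow_mul]
    norm_num
  constructor
  · refine Asymptotics.IsBigO.of_bound 4 ?_
    filter_upwards [Filter.eventually_ge_atTop 2] with m hm
    have hs : 0 < Real.sqrt m := Real.sqrt_pos.2 (by exact_mod_cast (by omega : 0 < m))
    rw [Real.norm_of_nonneg (by positivity), Real.norm_of_nonneg (by positivity),
      ← mul_div_assoc, le_div_iff₀ hs]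
    refine (pow_le_pow_iff_left₀ (by positivity) (by positivity) two_ne_zero).1 ?_
    have h : (m : ℝ) * (undefinedThreshold m : ℝ) ^ 2 ≤ 16 * 4 ^ m := by
      exact_mod_cast mul_undefinedThreshold_sq_le hm
    rw [mul_pow, mul_pow, Real.sq_sqrt (by positivity), four_pow]
    linarith
  -- Any constant whose square is at least 32 works.
  · refine Asymptotics.IsBigO.of_bound 6 ?_
    filter_upwards [Filter.eventually_ge_atTop 2] with m hm
    have hs : 0 < Real.sqrt m := Real.sqrt_pos.2 (by exact_mod_cast (by omega : 0 < m))
    rw [Real.norm_of_nonneg (by positivity), Real.norm_of_nonneg (by positivity),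
      div_le_iff₀ hs]
    refine (pow_le_pow_iff_left₀ (by positivity) (by positivity) two_ne_zero).1 ?_
    have h : (4 : ℝ) ^ m ≤ 32 * (m * (undefinedThreshold m : ℝ) ^ 2) := by
      exact_mod_cast four_pow_le_mul_undefinedThreshold_sq hm
    rw [mul_pow, mul_pow, Real.sq_sqrt (by positivity), four_pow]
    have : 0 ≤ (m : ℝ) * (undefinedThreshold m : ℝ) ^ 2 := by positivity
    linarith

/-! ### Protocols and parity queries -/

theorem HasNADT.hasOneWayProtocol {n p : ℕ} {f : PartialBoolFun n} (hf : HasNADT f p) :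
    HasOneWayProtocol (xorFun f) p := by
  obtain ⟨s, l, hl⟩ := hf
  refine ⟨fun x i => s i ⬝ᵥ x, fun c y => l (c + fun i => s i ⬝ᵥ y), fun x y b hb => ?_⟩
  rw [← hl (x + y) b hb]
  exact congrArg l (funext fun i => (dotProduct_add (s i) x y).symm)

/-- A partial function which is constant on the cosets of a subspace of dimension at least `n - p`
is computed by `p` parities. -/
theorem hasNADT_of_constant_on_cosets {n p : ℕ} {f : PartialBoolFun n}
    (V : Submodule (ZMod 2) (Cube n)) (hV : n ≤ Module.finrank (ZMod 2) V + p)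
    (hf : ∀ x y : Cube n, x - y ∈ V → ∀ a b : ZMod 2, f x = some a → f y = some b → a = b) :
    HasNADT f p := by
  have hrank : Module.finrank (ZMod 2) (Cube n ⧸ V) ≤ Module.finrank (ZMod 2) (Cube p) := by
    have := V.finrank_quotient_add_finrank
    rw [Module.finrank_fin_fun] at this ⊢
    omega
  obtain ⟨g, hg⟩ : ∃ g : (Cube n ⧸ V) →ₗ[ZMod 2] Cube p, Function.Injective g :=
    finrank_le_iff_exists_linearMap.1 hrank
  let M := LinearMap.toMatrix' (g ∘ₗ V.mkQ)
  have hM (x : Cube n) : (fun i => M i ⬝ᵥ x) = g (V.mkQ x) :=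
    LinearMap.toMatrix'_mulVec (g ∘ₗ V.mkQ) x
  classical
  -- Any defined value above `c` will do, by constancy on cosets; 0 is a filler where there is none.
  refine ⟨M, fun c => if h : ∃ b x, g (V.mkQ x) = c ∧ f x = some b then h.choose else 0,
    fun x b hb => ?_⟩
  rw [hM]
  have h : ∃ b y, g (V.mkQ y) = g (V.mkQ x) ∧ f y = some b := ⟨b, x, rfl, hb⟩
  simp only [dif_pos h]
  obtain ⟨y, hy, hfy⟩ := h.choose_spec
  exact hf y x ((Submodule.Quotient.eq V).1 (hg hy)) _ _ hfy hb

/-- If shifting by the elements of a large set never changes a defined value of `f` to another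
defined value, and `f` is undefined on few inputs, then `f` is constant on the cosets of the
span of that set. -/
theorem constant_on_cosets_span {n : ℕ} {f : PartialBoolFun n} {D : Finset (Cube n)}
    (h0 : 0 ∈ D) (hcard : 2 * (undefinedInputs f).card < D.card)
    (hD : ∀ d ∈ D, ∀ (z : Cube n) (a b : ZMod 2), f z = some a → f (z + d) = some b → a = b)
    {x y : Cube n} (hxy : x - y ∈ Submodule.span (ZMod 2) (D : Set (Cube n))) {a b : ZMod 2}
    (hx : f x = some a) (hy : f y = some b) : a = b := by
  classical
  set V := Submodule.span (ZMod 2) (D : Set (Cube n)) with hVdef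
  by_contra hab
  have hDV : ∀ d ∈ D, d ∈ V := fun d hd => Submodule.subset_span hd
  let D' : Finset V := Finset.univ.filter fun v => (v : Cube n) ∈ D
  let B : Finset V := Finset.univ.filter fun v => f (y + v) = some b
  have hD'card : D'.card = D.card := by
    rw [← Finset.card_map (Function.Embedding.subtype _)]
    congr 1
    ext d
    simpa [D'] using hDV d
  have htop : AddSubgroup.closure (D' : Set V) = ⊤ := by
    have hspan : Submodule.span (ZMod 2) (D' : Set V) = ⊤ := by
      have hD' : (D' : Set V) = ((↑) : V → Cube n) ⁻¹' (D : Set (Cube n)) := by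
        ext v
        simp [D']
      rw [hD', hVdef]
      exact Submodule.span_span_coe_preimage
    -- Over `ZMod 2` every additive subgroup is a subspace.
    have hle : Submodule.span (ZMod 2) (D' : Set V) ≤
        AddSubgroup.toZModSubmodule 2 (AddSubgroup.closure (D' : Set V)) :=
      Submodule.span_le.2 AddSubgroup.subset_closure
    exact (AddSubgroup.eq_top_iff' _).2 fun v => hle (hspan ▸ Submodule.mem_top)
  have hBD : B + D' ≠ Finset.univ := fun h => by
    obtain ⟨v, hv, d, hd, hvd⟩ := Finset.mem_add.1 (h ▸ Finset.mem_univ (⟨x - y, hxy⟩ : V))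
    have hvd' : (v : Cube n) + d = x - y := congrArg Subtype.val hvd
    refine hab (hD d (Finset.mem_filter.1 hd).2 (y + v) b a (Finset.mem_filter.1 hv).2 ?_).symm
    rw [add_assoc, hvd', add_sub_cancel, hx]
  have holson := Finset.card_le_two_mul_card_add_sub_card (D := D') (B := B)
    (by simpa [D'] using h0)
    (fun d hd => by rwa [ZModModule.neg_eq_self]) htop ⟨0, by simpa [B] using hy⟩ hBD
  have hU : ((B + D') \ B).card ≤ (undefinedInputs f).card := by
    refine Finset.card_le_card_of_injOn (fun v => y + v) (fun v hv => ?_)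
      fun v _ w _ hvw => Subtype.ext (add_left_cancel hvw)
    obtain ⟨hv, hvB⟩ := Finset.mem_sdiff.1 hv
    obtain ⟨u, hu, d, hd, rfl⟩ := Finset.mem_add.1 hv
    simp only [undefinedInputs, Finset.coe_filter, Finset.mem_univ, true_and, Set.mem_ofPred_eq]
    by_contra hne
    obtain ⟨c, hc⟩ := Option.ne_none_iff_exists'.1 hne
    refine hvB (Finset.mem_filter.2 ⟨Finset.mem_univ _, ?_⟩)
    rw [hc, hD d (Finset.mem_filter.1 hd).2 (y + u) b c (Finset.mem_filter.1 hu).2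
      (by rw [← hc, add_assoc]; rfl)]
  have := Finset.le_card_sdiff B (B + D')
  omega

/-- A one-way protocol with `t` bits gives `t` parity queries when `f` is undefined on few
inputs. -/
theorem HasOneWayProtocol.hasNADT {n t : ℕ} {f : PartialBoolFun n} (htn : t ≤ n)
    (hF : HasOneWayProtocol (xorFun f) t)
    (hU : (undefinedInputs f).card < undefinedThreshold (n - t)) : HasNADT f t := by
  classical
  obtain ⟨h, φ, hφ⟩ := hF
  obtain ⟨c, hc⟩ := Fintype.exists_le_card_fiber_of_mul_le_card (n := 2 ^ (n - t)) h (by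
    simp only [Fintype.card_fun, ZMod.card, Fintype.card_fin]
    rw [← pow_add, Nat.add_sub_cancel' htn])
  set A : Finset (Cube n) := Finset.univ.filter fun x => h x = c
  obtain ⟨a₀, ha₀⟩ : A.Nonempty := Finset.card_pos.1 (lt_of_lt_of_le (by positivity) hc)
  have hA : ∀ x ∈ A, h x = c := fun x hx => (Finset.mem_filter.1 hx).2
  have hDcard : 2 ^ (n - t) ≤ (A + A).card :=
    hc.trans (Finset.card_le_card_add_right ⟨a₀, ha₀⟩)
  refine hasNADT_of_constant_on_cosets (Submodule.span (ZMod 2) ((A + A : Finset _) : Set (Cube n)))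
    ?_ fun x y hxy a b hx hy => constant_on_cosets_span ?_ ?_ ?_ hxy hx hy
  · have hle : 2 ^ (n - t) ≤ 2 ^ Module.finrank (ZMod 2)
        (Submodule.span (ZMod 2) ((A + A : Finset _) : Set (Cube n))) := by
      have hcardV := Module.card_eq_pow_finrank (K := ZMod 2)
        (V := Submodule.span (ZMod 2) ((A + A : Finset _) : Set (Cube n)))
      rw [ZMod.card] at hcardV
      rw [← hcardV]
      refine hDcard.trans ?_
      rw [← Fintype.card_coe]
      exact Fintype.card_le_of_injective
        (fun d => ⟨d, Submodule.subset_span d.2⟩) fun d e hde =>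
          Subtype.ext (Subtype.mk.inj hde)
    have := (Nat.pow_le_pow_iff_right (by norm_num)).1 hle
    omega
  · exact Finset.mem_add.2 ⟨a₀, ha₀, a₀, ha₀, ZModModule.add_self a₀⟩
  · have := two_mul_undefinedThreshold_le (n - t)
    omega
  · intro d hd z a b hz hzd
    obtain ⟨u, hu, v, hv, rfl⟩ := Finset.mem_add.1 hd
    -- `f z = F(u, z + u)` and `f (z + u + v) = F(v, z + u)`: Bob has the same input and receives
    -- the same message `c`.
    have h1 := hφ u (z + u) a (by rw [xorFun, add_left_comm, ZModModule.add_self, add_zero, hz])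
    have h2 := hφ v (z + u) b (by rw [xorFun, add_comm, add_assoc, hzd])
    rw [hA u hu] at h1
    rw [hA v hv] at h2
    exact h1.symm.trans h2

theorem oneWayCC_le_nadt {n : ℕ} (f : PartialBoolFun n) : oneWayCC (xorFun f) ≤ nadt f :=
  Nat.sInf_le (Nat.sInf_mem (s := {p | HasNADT f p}) ⟨n, hasNADT_self f⟩).hasOneWayProtocol

theorem mainTheorem1 :
    (∀ (n t : ℕ) (f : PartialBoolFun n),
      oneWayCC (xorFun f) = t →
      (undefinedInputs f).card < undefinedThreshold (n - t) →
      nadt f = t) ∧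
    Asymptotics.IsTheta Filter.atTop
      (fun m : ℕ => (undefinedThreshold m : ℝ))
      (fun m : ℕ => (2 : ℝ) ^ m / Real.sqrt (m : ℝ)) := by
  refine ⟨fun n t f ht hU => ?_, isTheta_undefinedThreshold⟩
  subst ht
  have hF : HasOneWayProtocol (xorFun f) (oneWayCC (xorFun f)) :=
    Nat.sInf_mem (s := {t | HasOneWayProtocol (xorFun f) t}) ⟨n, hasOneWayProtocol_self _⟩
  have hn : oneWayCC (xorFun f) ≤ n := Nat.sInf_le (hasOneWayProtocol_self _)
  exact le_antisymm (Nat.sInf_le (hF.hasNADT hn hU)) (oneWayCC_le_nadt f)
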